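/- Let $n\ge 3$ be an integer. For finite sets $\mathcal P\subset\mathbb R^n$ and $\mathcal H$ of sets in $\mathbb R^n$, let $I(\mathcal P,\mathcal H)$ be the number of incidences, that is, of pairs $(P,H)\in\mathcal P\times\mathcal H$ with $P\in H$. For every $\epsilon>0$ there is a constant $C_\epsilon>0$, depending only on $\epsilon$ and $n$, with the following property. Let $\mathcal H$ be a finite collection of (affine) hyperplanes in $\mathbb R^n$, let $\mathcal P$ be a finite collection of points in $\mathbb R^n$, and let $\gamma\ge 1$ be a real number. Assume that (a) $I(\mathcal P',\mathcal H')\le \gamma\bigl(|\mathcal P'|+|\mathcal H'|\,|\mathcal P'|^{\frac{n-3}{n-2}}\bigr)$ for all $\mathcal P'\subset\mathcal P$ and $\mathcal H'\subset\mathcal H$; (b) any $\gamma$ hyperplanes in $\mathcal H$ share fewer than $\gamma$ points in $\mathcal P$; that is, for each $\mathcal S\subset\mathcal H$ with $|\mathcal S|\ge\gamma$, fewer than $\gamma$ points of $\mathcal P$ lie in all the hyperplanes of $\mathcal S$. Then $$I(\mathcal P,\mathcal H)\le C_\epsilon\,\gamma\Bigl(|\mathcal P|^{\alpha}|\mathcal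 H|^{\beta}+|\mathcal P|+|\mathcal H|\,(1+\log_2|\mathcal P|)\Bigr),$$ where $\alpha=\frac{n(n-3)}{n^2-2n-1}$ and $\beta=\frac{(n-1)(n-2)}{n^2-2n-1}+\epsilon$ (and, for $\mathcal P=\emptyset$, $\log_2 0$ is read as $0$). -/

import Mathlib

namespace PointHyperplane

/-- A subset of `ℝⁿ` is a hyperplane if it is `{x | ⟨a, x⟩ = b}` with `a ≠ 0`
(an affine hyperplane, not necessarily through the origin). -/
def IsHyperplane {n : ℕ} (H : Set (EuclideanSpace ℝ (Fin n))) : Prop :=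
  ∃ (a : EuclideanSpace ℝ (Fin n)) (b : ℝ), a ≠ 0 ∧ H = {x | inner ℝ a x = b}

open Classical in
/-- The number of incidences: pairs `(p, h)` with `p ∈ P`, `h ∈ H` and `p ∈ h`. -/
noncomputable def incidences {X : Type*} (P : Finset X) (H : Finset (Set X)) : ℕ :=
  ((P ×ˢ H).filter fun q => q.1 ∈ q.2).card

open Classical in
/-- The set of points of `P` that lie in every member of `S`. -/
noncomputable def sharedPoints {X : Type*} (P : Finset X) (S : Finset (Set X)) : Finset X :=
  P.filter fun p => ∀ h ∈ S, p ∈ h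

end PointHyperplane

/-! Duality sends the hyperplane `⟨a, x⟩ = b` to the vector `(a, b)` of `ℝⁿ⁺¹` and a point `p` to
the functional `(a, b) ↦ ⟨p, a⟩ - b`, so that incidence becomes vanishing. A cutting
(`exists_cutting`) splits the hyperplanes into at most `R ^ (n + ε)` classes such that, for each
class, at most `|P| / R` points lie on some but not all of its members. Points on every member of a
class are controlled by (b), points on none do not count, and the crossing points are treated
recursively. After `j` rounds (a) finishes the estimate (`incidences_le_of_cuttings`). The exponents
come from balancing `|P| ρ ^ (n - 1)` against `|H| (|P| / ρ) ^ ((n - 3) / (n - 2))`, where `ρ ≈ R ^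
j` (`exists_iteration_count`); the logarithm is the number of rounds.

The cutting comes from a random sample of `s` functionals. The cells of its arrangement are
triangulated into `O(s ^ n)` simplicial cones (`exists_triangulation`), and for some sample no two
vertices of a common closed cell are strictly separated by more than a `q`-fraction of all
functionals (`exists_separating_sample`). The class of a vector is the face of a cone carrying it in
its relative interior. A functional vanishing somewhere but not everywhere on a class must strictly
separate two vertices of the face, so few functionals cross it. -/

open Module

/-! ### Cells and facets of a central arrangement -/

/-- `v` spans a one-dimensional intersection of kernels of members of the family `g`. -/
def IsVertex {ι V : Type*} [AddCommGroup V] [Module ℝ V] (g : ι → Dual ℝ V) (v : V) : Prop :=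
  v ≠ 0 ∧ ∀ w, (∀ i, g i v = 0 → g i w = 0) → ∃ c : ℝ, w = c • v

/-- `y` lies on none of the hyperplanes defined by the nonzero members of `g`. -/
def IsGeneric {ι V : Type*} [AddCommGroup V] [Module ℝ V] (g : ι → Dual ℝ V) (y : V) : Prop :=
  ∀ i, g i ≠ 0 → g i y ≠ 0

/-- No member of `g` takes values of opposite strict signs at `x` and `y`. -/
def Conform {ι V : Type*} [AddCommGroup V] [Module ℝ V] (g : ι → Dual ℝ V) (x y : V) : Prop :=
  ∀ i, 0 ≤ g i x * g i y

theorem exists_pos_perturbation {ι : Type*} [Finite ι] (a b : ι → ℝ) :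
    ∃ δ : ℝ, 0 < δ ∧ ∀ i, 0 < a i → 0 < a i + δ * b i := by
  have h : ∀ᶠ δ : ℝ in nhdsWithin 0 (Set.Ioi 0), ∀ i, 0 < a i → 0 < a i + δ * b i := by
    rw [Filter.eventually_all]
    intro i
    by_cases hi : 0 < a i
    · have : Filter.Tendsto (fun δ : ℝ => a i + δ * b i) (nhdsWithin 0 (Set.Ioi 0))
          (nhds (a i + 0 * b i)) :=
        ((continuous_const.add (continuous_id.mul continuous_const)).tendsto 0).mono_left
          nhdsWithin_le_nhds
      rw [zero_mul, add_zero] at this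
      filter_upwards [this.eventually (lt_mem_nhds hi)] with δ hδ _ using hδ
    · exact Filter.Eventually.of_forall fun δ h => absurd h hi
  obtain ⟨δ, h1, h2⟩ := (h.and self_mem_nhdsWithin).exists
  exact ⟨δ, h2, h1⟩

section
variable {ι V : Type*} [AddCommGroup V] [Module ℝ V]

theorem exists_generic [Finite ι] (g : ι → Dual ℝ V) : ∃ u, IsGeneric g u := by
  obtain ⟨u, hu⟩ := Dual.exists_forall_ne_zero_of_forall_exists
    (fun i : {i // g i ≠ 0} => g i.1) (fun i => by
      by_contra! h
      exact i.2 (LinearMap.ext h))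
  exact ⟨u, fun i hi => hu ⟨i, hi⟩⟩

theorem exists_generic_conform [Finite ι] (g : ι → Dual ℝ V) (x : V) :
    ∃ y, IsGeneric g y ∧ Conform g x y := by
  obtain ⟨u, hu⟩ := exists_generic g
  obtain ⟨δ, hδ, h⟩ := exists_pos_perturbation (fun i => g i x * g i x) (fun i => g i x * g i u)
  refine ⟨x + δ • u, fun i hi h0 => ?_, fun i => ?_⟩
  · by_cases hx : g i x = 0
    · simp [hx, hδ.ne', hu i hi] at h0
    · have := h i (mul_self_pos.2 hx)
      simp only [map_add, map_smul, smul_eq_mul] at h0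
      have h2 : g i x * (g i x + δ * g i u) = 0 := by rw [h0, mul_zero]
      linarith
  · by_cases hx : g i x = 0
    · simp [hx]
    · have := h i (mul_self_pos.2 hx)
      simp only [map_add, map_smul, smul_eq_mul]
      linarith

/-- A point `x` on the boundary of the cell of `y` lies on a facet, with `y'` in its relative
interior. After scaling the functionals to equal 1 at `y`, the one smallest at a generic `u` among
those vanishing at `x` gives the facet: moving slightly from `x` along `u - f i u • y` stays on it
and makes every other functional, except copies of `f i`, positive. -/
theorem exists_facet [Finite ι] (g : ι → Dual ℝ V) {x y : V} (hy : IsGeneric g y)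
    (hxy : Conform g x y) (hx : ∃ i, g i ≠ 0 ∧ g i x = 0) :
    ∃ i, g i ≠ 0 ∧ g i x = 0 ∧ ∃ y', g i y' = 0 ∧ Conform g y' y ∧
      ∀ j, (∃ w, g i w = 0 ∧ g j w ≠ 0) → g j y' ≠ 0 := by
  classical
  have := Fintype.ofFinite ι
  set f : ι → Dual ℝ V := fun j => (g j y)⁻¹ • g j with hf
  have hfy : ∀ j, g j ≠ 0 → f j y = 1 := fun j hj => by simp [hf, hy j hj]
  have hfg : ∀ j w, g j ≠ 0 → g j w = g j y * f j w := fun j w hj => by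
    have := hy j hj
    simp [hf]; field_simp
  have hfx : ∀ j, g j ≠ 0 → 0 ≤ f j x := fun j hj => by
    have h1 := hxy j
    rw [hfg j x hj] at h1
    have h2 := mul_self_pos.2 (hy j hj)
    by_contra! h3
    nlinarith
  obtain ⟨u, hu⟩ := exists_generic (fun p : ι × ι => f p.1 - f p.2)
  let A : Finset ι := Finset.univ.filter fun i => g i ≠ 0 ∧ g i x = 0
  obtain ⟨i, hiA, hmin⟩ := Finset.exists_min_image A (fun j => f j u)
    (by obtain ⟨i, hi⟩ := hx; exact ⟨i, by simp [A, hi]⟩)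
  have hi : g i ≠ 0 ∧ g i x = 0 := by simpa [A] using hiA
  set z := u - f i u • y with hz
  obtain ⟨δ, hδ, hpert⟩ := exists_pos_perturbation (fun j => f j x) (fun j => f j z)
  have hfz : ∀ j, g j ≠ 0 → f j z = f j u - f i u := fun j hj => by
    simp [hz, hfy j hj]
  have hfix : f i x = 0 := by simp [hf, hi.2]
  have hval : ∀ j, g j ≠ 0 → f j ≠ f i → 0 < f j (x + δ • z) := by
    intro j hj hji
    simp only [map_add, map_smul, smul_eq_mul]
    rcases (hfx j hj).lt_or_eq with h | h
    · exact hpert j h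
    · rw [← h, zero_add, hfz j hj]
      refine mul_pos hδ (sub_pos.2 (lt_of_le_of_ne (hmin j ?_) ?_))
      · have : g j x = 0 := by rw [hfg j x hj, ← h, mul_zero]
        simp [A, hj, this]
      · intro h2
        exact hu (i, j) (sub_ne_zero.2 (Ne.symm hji)) (by simp [h2])
  have hval0 : f i (x + δ • z) = 0 := by
    simp only [map_add, map_smul, smul_eq_mul, hfix, hfz i hi.1]; simp
  refine ⟨i, hi.1, hi.2, x + δ • z, ?_, fun j => ?_, ?_⟩
  · rw [hfg i _ hi.1, hval0, mul_zero]
  · by_cases hj : g j = 0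
    · simp [hj]
    by_cases hji : f j = f i
    · rw [hfg j (x + δ • z) hj, hji, hval0]; simp
    · rw [hfg j (x + δ • z) hj]
      have := mul_pos (mul_self_pos.2 (hy j hj)) (hval j hj hji)
      nlinarith
  · rintro j ⟨w, hw1, hw2⟩
    have hj : g j ≠ 0 := by rintro h; simp [h] at hw2
    have hji : f j ≠ f i := by
      intro h
      apply hw2
      rw [hfg j w hj, h]
      simp [hf, hw1]
    rw [hfg j _ hj]
    exact mul_ne_zero (hy j hj) (hval j hj hji).ne'

/-- The least ratio `g j x / g j v` is the time at which the ray from `x` in direction `-v` leaves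
the closed cell. -/
theorem exists_exit [Finite ι] (g : ι → Dual ℝ V) {x y v : V} (hy : IsGeneric g y)
    (hxy : Conform g x y) (hvy : Conform g v y) (hv : ∃ i, g i v ≠ 0) :
    ∃ t : ℝ, 0 ≤ t ∧ Conform g (x - t • v) y ∧ ∃ i, g i ≠ 0 ∧ g i (x - t • v) = 0 := by
  classical
  have := Fintype.ofFinite ι
  have hpos : ∀ i, g i v ≠ 0 → 0 < g i v * g i y := fun i hi =>
    lt_of_le_of_ne (hvy i) (Ne.symm (mul_ne_zero hi (hy i (by rintro h; simp [h] at hi))))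
  let A : Finset ι := Finset.univ.filter fun i => g i v ≠ 0
  obtain ⟨i, hiA, hmin⟩ := Finset.exists_min_image A (fun j => g j x / g j v)
    (by obtain ⟨i, hi⟩ := hv; exact ⟨i, by simp [A, hi]⟩)
  have hi : g i v ≠ 0 := by simpa [A] using hiA
  refine ⟨g i x / g i v, ?_, fun j => ?_, i, by rintro h; simp [h] at hi, ?_⟩
  · have h1 := hxy i
    have h2 := hpos i hi
    have h3 : g i x / g i v = (g i x * g i y) / (g i v * g i y) := by
      have := right_ne_zero_of_mul h2.ne'
      field_simp
    rw [h3]; positivity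
  · by_cases hj : g j v = 0
    · simpa [hj] using hxy j
    · have h1 := hmin j (by simp [A, hj])
      simp only [map_sub, map_smul, smul_eq_mul]
      have h2 : (g j x - g i x / g i v * g j v) * g j y
          = (g j x / g j v - g i x / g i v) * (g j v * g j y) := by field_simp
      rw [h2]
      exact mul_nonneg (sub_nonneg.2 h1) (hpos j hj).le
  · simp only [map_sub, map_smul, smul_eq_mul]; field_simp; ring

end

/-! ### Triangulating the cells -/

/-- The sign vector of `y` with respect to `g`. -/
noncomputable def signVector {ι V : Type*} [AddCommGroup V] [Module ℝ V] (g : ι → Dual ℝ V)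
    (y : V) : ι → SignType := fun i => SignType.sign (g i y)

theorem Conform.of_signVector_eq {ι V : Type*} [AddCommGroup V] [Module ℝ V]
    {g : ι → Dual ℝ V} {x y y' : V} (h : signVector g y = signVector g y') (hx : Conform g x y) :
    Conform g x y' := by
  intro i
  have h1 := hx i
  have h2 := congrFun h i
  simp only [signVector] at h2
  rw [← sign_nonneg_iff, sign_mul, ← h2, ← sign_mul, sign_nonneg_iff]
  exact h1

/-- The sign vector of a full-dimensional cell adjacent to a facet on the `i`-th hyperplane. -/
noncomputable def extendSign {ι V : Type*} [AddCommGroup V] [Module ℝ V] (g : ι → Dual ℝ V)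
    (z : V) (σ : ι → SignType) (e : SignType) : ι → SignType :=
  fun j => if σ j ≠ 0 then σ j else SignType.sign (g j z) * e

/-- A functional vanishing at the facet point `y'` vanishes on all of `ker (g i)`, so it equals `g j
z` times `g i`. The facet and the side of it therefore determine the cell, which is what bounds the
number of cells by that of facets. -/
theorem signVector_eq_extendSign {ι V : Type*} [AddCommGroup V] [Module ℝ V]
    {g : ι → Dual ℝ V} {y y' z : V} {i : ι} (hy : IsGeneric g y) (hz : g i z = 1)
    (hyy : Conform g y' y)
    (hgen : ∀ j, (∃ w, g i w = 0 ∧ g j w ≠ 0) → g j y' ≠ 0) :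
    signVector g y = extendSign g z (signVector g y') (SignType.sign (g i y)) := by
  funext j
  by_cases h : g j y' = 0
  · have h1 : g j (y - g i y • z) = 0 := by
      by_contra h2
      exact hgen j ⟨_, by simp [hz], h2⟩ h
    have h2 : g j y = g j z * g i y := by
      simp only [map_sub, map_smul, smul_eq_mul] at h1
      linarith
    simp [signVector, extendSign, h, h2, sign_mul]
  · have hj : g j ≠ 0 := by rintro h'; simp [h'] at h
    have h1 : 0 < g j y' * g j y := lt_of_le_of_ne (hyy j) (mul_ne_zero h (hy j hj)).symm
    simp only [signVector, extendSign, ne_eq, sign_eq_zero_iff, h, not_false_eq_true, if_true]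
    rcases pos_and_pos_or_neg_and_neg_of_mul_pos h1 with ⟨a, b⟩ | ⟨a, b⟩
    · rw [sign_pos a, sign_pos b]
    · rw [sign_neg a, sign_neg b]

/-- `T` spans a simplicial cone through `x`, with vertices of the arrangement of `g` in the
closed cell of `y`. -/
def IsSimplexThrough {ι V : Type*} [AddCommGroup V] [Module ℝ V] (g : ι → Dual ℝ V)
    (y x : V) (k : ℕ) (T : Finset V) : Prop :=
  T.card ≤ k ∧ (∀ v ∈ T, IsVertex g v ∧ Conform g v y) ∧
    ∃ t : V → ℝ, (∀ v, 0 ≤ t v) ∧ x = ∑ v ∈ T, t v • v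

theorem IsSimplexThrough.insert {ι V : Type*} [AddCommGroup V] [Module ℝ V] [DecidableEq V]
    {g : ι → Dual ℝ V} {y x v : V} {k : ℕ} {T : Finset V} {t : ℝ} (ht : 0 ≤ t)
    (h : IsSimplexThrough g y (x - t • v) k T) (hv : IsVertex g v) (hvy : Conform g v y) :
    IsSimplexThrough g y x (k + 1) (insert v T) := by
  obtain ⟨h1, h2, c, hc, hx⟩ := h
  refine ⟨(Finset.card_insert_le _ _).trans (by lia), ?_,
    -- The apex `v` may already belong to `T`; its coefficients then add up.
    fun u => (if u ∈ T then c u else 0) + if u = v then t else 0, fun u => ?_, ?_⟩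
  · intro u hu
    rcases Finset.mem_insert.1 hu with rfl | hu
    · exact ⟨hv, hvy⟩
    · exact h2 u hu
  · have := hc u
    dsimp only
    split_ifs <;> linarith
  · simp only [add_smul, Finset.sum_add_distrib, ite_smul, zero_smul]
    rw [Finset.sum_ite_eq', if_pos (Finset.mem_insert_self _ _), ← Finset.sum_filter,
      Finset.filter_mem_eq_inter, Finset.inter_eq_right.2 (Finset.subset_insert _ _), ← hx]
    abel

theorem Conform.trans {ι V : Type*} [AddCommGroup V] [Module ℝ V]
    {g : ι → Dual ℝ V} {y y' v : V} {i : ι} (hyy : Conform g y' y)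
    (hgen : ∀ j, (∃ w, g i w = 0 ∧ g j w ≠ 0) → g j y' ≠ 0)
    (hv : g i v = 0) (h : Conform g v y') : Conform g v y := by
  intro j
  by_cases hj : g j y' = 0
  · have : g j v = 0 := by
      by_contra h2
      exact hgen j ⟨v, hv, h2⟩ hj
    simp [this]
  · have h1 := h j
    have h2 := hyy j
    have h3 := mul_self_pos.2 hj
    by_contra! h4
    nlinarith [mul_nonneg h1 h2]

theorem IsSimplexThrough.of_ker {ι V : Type*} [AddCommGroup V] [Module ℝ V] [DecidableEq V]
    {g : ι → Dual ℝ V} {i : ι} {y x : LinearMap.ker (g i)} {k : ℕ}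
    {T : Finset (LinearMap.ker (g i))}
    (h : IsSimplexThrough (fun j => g j ∘ₗ (LinearMap.ker (g i)).subtype) y x k T) :
    IsSimplexThrough g (y : V) (x : V) k (T.image Subtype.val) ∧
      ∀ v ∈ T.image Subtype.val, g i v = 0 := by
  classical
  obtain ⟨h1, h2, c, hc, hx⟩ := h
  refine ⟨⟨Finset.card_image_le.trans h1, ?_,
    fun v => if hv : v ∈ LinearMap.ker (g i) then c ⟨v, hv⟩ else 0, ?_, ?_⟩, ?_⟩
  · intro v hv
    obtain ⟨u, hu, rfl⟩ := Finset.mem_image.1 hv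
    obtain ⟨⟨hu0, huv⟩, huy⟩ := h2 u hu
    refine ⟨⟨fun h => hu0 (Subtype.ext h), fun w hw => ?_⟩, huy⟩
    obtain ⟨a, ha⟩ := huv ⟨w, hw i u.2⟩ (fun j hj => hw j hj)
    exact ⟨a, congrArg Subtype.val ha⟩
  · intro v
    dsimp only
    split_ifs
    · exact hc _
    · exact le_rfl
  · rw [Finset.sum_image (fun a _ b _ h => Subtype.ext h), hx]
    simp
  · intro v hv
    obtain ⟨u, hu, rfl⟩ := Finset.mem_image.1 hv
    exact u.2

theorem exists_triangulation_of_finrank_eq_one {ι : Type*} [Fintype ι] {V : Type*}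
    [AddCommGroup V] [Module ℝ V] (hV : finrank ℝ V = 1) (g : ι → Dual ℝ V)
    (hg : ∀ x, (∀ i, g i x = 0) → x = 0) :
    ∃ 𝒯 : Finset ((ι → SignType) × Finset V), 𝒯.card ≤ 2 ∧
      ∀ y, IsGeneric g y → ∀ x, Conform g x y →
        ∃ T, (signVector g y, T) ∈ 𝒯 ∧ IsSimplexThrough g y x 1 T := by
  classical
  obtain ⟨e, he, hspan⟩ := finrank_eq_one_iff'.1 hV
  obtain ⟨i, hi⟩ : ∃ i, g i e ≠ 0 := by
    by_contra! h
    exact he (hg e h)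
  have hgi : g i ≠ 0 := by rintro h; simp [h] at hi
  refine ⟨{(signVector g e, {e}), (signVector g (-e), {-e})}, Finset.card_le_two, ?_⟩
  have key : ∀ e', e' ≠ 0 → ∀ c a : ℝ, 0 < c → Conform g (a • e') (c • e') →
      (∀ w, ∃ b : ℝ, w = b • e') → g i e' ≠ 0 →
      signVector g (c • e') = signVector g e' ∧
        IsSimplexThrough g (c • e') (a • e') 1 {e'} := by
    intro e' he' c a hc hconf hs hi'
    refine ⟨?_, by simp, ?_, fun _ => a, fun _ => ?_, by simp⟩
    · funext j
      simp [signVector, sign_mul, sign_pos hc]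
    · intro v hv
      rw [Finset.mem_singleton.1 hv]
      refine ⟨⟨he', fun w _ => hs w⟩, fun j => ?_⟩
      simp only [map_smul, smul_eq_mul]
      nlinarith [mul_nonneg hc.le (mul_self_nonneg (g j e'))]
    · have h1 := hconf i
      simp only [map_smul, smul_eq_mul] at h1
      have h2 := mul_self_pos.2 hi'
      by_contra! h3
      have := mul_pos (mul_pos (neg_pos.2 h3) hc) h2
      nlinarith
  intro y hy x hxy
  obtain ⟨c, rfl⟩ := hspan y
  obtain ⟨a, rfl⟩ := hspan x
  rcases lt_trichotomy c 0 with hc | hc | hc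
  · have e1 : c • e = (-c) • (-e) := by simp
    have e2 : a • e = (-a) • (-e) := by simp
    rw [e1] at hxy ⊢
    rw [e2] at hxy ⊢
    obtain ⟨h1, h2⟩ := key (-e) (neg_ne_zero.2 he) (-c) (-a) (neg_pos.2 hc) hxy (fun w => by
      obtain ⟨b, rfl⟩ := hspan w
      exact ⟨-b, by simp⟩) (by simpa using hi)
    exact ⟨{-e}, by rw [h1]; simp, h2⟩
  · exact absurd (by simp [hc]) (hy i hgi)
  · obtain ⟨h1, h2⟩ := key e he c a hc hxy (fun w => (hspan w).imp fun _ => Eq.symm) hi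
    exact ⟨{e}, by simp [h1], h2⟩

/-- Induction on dimension by coning. Each cell gets an apex among its vertices; the ray from `x`
away from the apex exits through a facet, and the exit point is covered by the triangulation of the
arrangement induced on that hyperplane. Each facet cone borders at most two cells, whence a factor
`2 * Fintype.card ι` per dimension. -/
theorem exists_triangulation {ι : Type*} [Fintype ι] (d : ℕ) : ∀ (V : Type*) [AddCommGroup V]
    [Module ℝ V] [FiniteDimensional ℝ V], finrank ℝ V = d + 1 → ∀ g : ι → Dual ℝ V,
    (∀ x, (∀ i, g i x = 0) → x = 0) →
    ∃ 𝒯 : Finset ((ι → SignType) × Finset V), 𝒯.card ≤ 2 * (2 * Fintype.card ι) ^ d ∧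
      ∀ y, IsGeneric g y → ∀ x, Conform g x y →
        ∃ T, (signVector g y, T) ∈ 𝒯 ∧ IsSimplexThrough g y x (d + 1) T := by
  classical
  induction d with
  | zero =>
    intro V _ _ _ hV g hg
    simpa using exists_triangulation_of_finrank_eq_one (by simpa using hV) g hg
  | succ d ih =>
    intro V _ _ _ hV g hg
    have hfacet : ∀ i, ∃ 𝒯 : Finset ((ι → SignType) × Finset V),
        𝒯.card ≤ 2 * (2 * Fintype.card ι) ^ d ∧ (g i ≠ 0 → ∀ y' x', g i y' = 0 → g i x' = 0 →
          (∀ j, (∃ w, g i w = 0 ∧ g j w ≠ 0) → g j y' ≠ 0) → Conform g x' y' →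
          ∃ T, (signVector g y', T) ∈ 𝒯 ∧ IsSimplexThrough g y' x' (d + 1) T ∧
            ∀ v ∈ T, g i v = 0) := by
      intro i
      by_cases hi : g i = 0
      · exact ⟨∅, by simp, fun h => absurd hi h⟩
      obtain ⟨𝒯, hcard, h𝒯⟩ := ih (LinearMap.ker (g i))
        (by have := Dual.finrank_ker_add_one_of_ne_zero hi; lia)
        (fun j => g j ∘ₗ (LinearMap.ker (g i)).subtype)
        (fun x hx => Subtype.ext (hg x hx))
      refine ⟨𝒯.image (fun p => (p.1, p.2.image Subtype.val)), Finset.card_image_le.trans hcard,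
        fun _ y' x' hy' hx' hgen hconf => ?_⟩
      obtain ⟨T, hT, hT'⟩ := h𝒯 ⟨y', hy'⟩ (fun j hj => hgen j (by
        by_contra! h
        exact hj (LinearMap.ext fun w => h w w.2))) ⟨x', hx'⟩ hconf
      exact ⟨_, Finset.mem_image_of_mem _ hT, hT'.of_ker⟩
    choose 𝒯 hcard h𝒯 using hfacet
    obtain ⟨z, hz⟩ : ∃ z : ι → V, ∀ i, g i ≠ 0 → g i (z i) = 1 := by
      have : ∀ i, ∃ z : V, g i ≠ 0 → g i z = 1 := by
        intro i
        by_cases hi : g i = 0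
        · exact ⟨0, fun h => absurd hi h⟩
        · obtain ⟨w, hw⟩ : ∃ w, g i w ≠ 0 := by
            by_contra! h
            exact hi (LinearMap.ext h)
          exact ⟨(g i w)⁻¹ • w, fun _ => by simp [hw]⟩
      exact ⟨fun i => (this i).choose, fun i => (this i).choose_spec⟩
    have hne : ∀ x : V, x ≠ 0 → ∃ i, g i x ≠ 0 := fun x hx => by
      by_contra! h
      exact hx (hg x h)
    -- The apex depends on the sign vector alone, so all points of a cell share it and the list of
    -- cones stays finite.
    have hvert : ∀ σ : ι → SignType, ∃ v : V, ∀ y, IsGeneric g y → signVector g y = σ →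
        IsVertex g v ∧ Conform g v y := by
      intro σ
      by_cases hσ : ∃ y, IsGeneric g y ∧ signVector g y = σ
      swap
      · exact ⟨0, fun y h1 h2 => absurd ⟨y, h1, h2⟩ hσ⟩
      obtain ⟨y, hy, rfl⟩ := hσ
      have : Nontrivial V := nontrivial_of_finrank_pos (R := ℝ) (by lia)
      obtain ⟨x0, hx0⟩ := exists_ne (0 : V)
      obtain ⟨i0, hi0⟩ := hne x0 hx0
      obtain ⟨i, hi, -, y', hy', hyy, hgen⟩ := exists_facet g (x := 0) hy
        (fun i => by simp) ⟨i0, by rintro h; simp [h] at hi0, by simp⟩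
      obtain ⟨T, -, ⟨-, hT, c, -, hc⟩, hT0⟩ := h𝒯 i hi y' y' hy' hy' hgen
        (fun j => mul_self_nonneg _)
      obtain ⟨v, hv⟩ : T.Nonempty := by
        rw [Finset.nonempty_iff_ne_empty]
        rintro rfl
        have h1 := Dual.finrank_ker_add_one_of_ne_zero hi
        have : Nontrivial (LinearMap.ker (g i)) := nontrivial_of_finrank_pos (R := ℝ) (by lia)
        obtain ⟨w, hw⟩ := exists_ne (0 : LinearMap.ker (g i))
        obtain ⟨j, hj⟩ := hne w (fun h => hw (Subtype.ext h))
        exact hgen j ⟨w, w.2, hj⟩ (by simp [hc])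
      refine ⟨v, fun y1 hy1 h1 => ⟨(hT v hv).1, ?_⟩⟩
      exact Conform.of_signVector_eq h1.symm (hyy.trans hgen (hT0 v hv) (hT v hv).2)
    choose v hv using hvert
    -- Each cone in a facet is joined to the apex of the cell on either side.
    refine ⟨Finset.univ.biUnion fun i => ((𝒯 i) ×ˢ ({1, -1} : Finset SignType)).image
      fun p => (extendSign g (z i) p.1.1 p.2, insert (v (extendSign g (z i) p.1.1 p.2)) p.1.2),
      ?_, ?_⟩
    · refine Finset.card_biUnion_le.trans ((Finset.sum_le_card_nsmul _ _
        (2 * (2 * Fintype.card ι) ^ d * 2) fun i _ => Finset.card_image_le.trans ?_).trans ?_)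
      · rw [Finset.card_product]
        exact Nat.mul_le_mul (hcard i) Finset.card_le_two
      · rw [Finset.card_univ, smul_eq_mul, pow_succ]
        apply le_of_eq; ring
    · intro y hy x hxy
      obtain ⟨hv1, hv2⟩ := hv _ y hy rfl
      obtain ⟨t, ht, hconf, hex⟩ := exists_exit g hy hxy hv2 (hne _ hv1.1)
      obtain ⟨i, hi, hix, y', hy', hyy, hgen⟩ := exists_facet g hy hconf hex
      have hconf' : Conform g (x - t • v (signVector g y)) y' := by
        intro j
        by_cases hj : g j y' = 0
        · simp [hj]
        have hj0 : g j ≠ 0 := by rintro h; simp [h] at hj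
        have h1 := hconf j
        have h2 := hyy j
        have h3 := mul_self_pos.2 (hy j hj0)
        by_contra! h4
        nlinarith [mul_nonneg h1 h2]
      obtain ⟨T, hT, hT', hT0⟩ := h𝒯 i hi y' _ hy' hix hgen hconf'
      have hsign := signVector_eq_extendSign hy (hz i hi) hyy hgen
      refine ⟨insert (v (signVector g y)) T, ?_, IsSimplexThrough.insert ht
        ⟨hT'.1, fun u hu => ⟨(hT'.2.1 u hu).1, hyy.trans hgen (hT0 u hu) (hT'.2.1 u hu).2⟩,
          hT'.2.2⟩ hv1 hv2⟩
      refine Finset.mem_biUnion.2 ⟨i, Finset.mem_univ _, Finset.mem_image.2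
        ⟨((signVector g y', T), SignType.sign (g i y)), ?_, ?_⟩⟩
      · refine Finset.mem_product.2 ⟨hT, ?_⟩
        rcases lt_or_gt_of_ne (hy i hi) with h | h
        · simp [sign_neg h]
        · simp [sign_pos h]
      · simp only [← hsign]

/-! ### Random sampling -/

/-- Once the coordinates in `I` are fixed, `D` is a fixed set, and each of the remaining `s -
I.card` coordinates avoids it with probability at most `1 - q`. -/
theorem card_samples_missing_le {J : Type*} [Fintype J] [DecidableEq J] {s k : ℕ}
    (I : Finset (Fin s)) (hI : I.card ≤ k) (D : (Fin s → J) → Finset J)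
    (hD : ∀ ω ω', (∀ i ∈ I, ω i = ω' i) → D ω = D ω') {q : ℝ} (hq0 : 0 ≤ q) (hq1 : q ≤ 1) :
    ((Finset.univ.filter fun ω : Fin s → J =>
        q * Fintype.card J ≤ (D ω).card ∧ ∀ i, ω i ∉ D ω).card : ℝ) ≤
      (Fintype.card J : ℝ) ^ s * (1 - q) ^ (s - k) := by
  set m := Fintype.card J with hm
  have hIs : I.card ≤ s := by simpa using I.card_le_univ
  rw [Finset.card_eq_sum_card_fiberwise (f := fun ω : Fin s → J => fun i : I => ω i)
    (t := Finset.univ) (fun _ _ => Finset.mem_coe.2 (Finset.mem_univ _))]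
  push_cast
  refine (Finset.sum_le_card_nsmul _ _ (((1 - q) * m) ^ (s - I.card)) fun ρ _ => ?_).trans ?_
  · rcases Finset.eq_empty_or_nonempty ((Finset.univ.filter fun ω : Fin s → J =>
        q * m ≤ (D ω).card ∧ ∀ i, ω i ∉ D ω).filter
        fun ω => (fun i : I => ω i) = ρ) with h | ⟨ω0, h0⟩
    · rw [h]
      simp only [Finset.card_empty, Nat.cast_zero]
      have : 0 ≤ 1 - q := by linarith
      positivity
    simp only [Finset.mem_filter, Finset.mem_univ, true_and] at h0
    obtain ⟨⟨h1, -⟩, rfl⟩ := h0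
    have hsub : ((Finset.univ.filter fun ω : Fin s → J =>
        q * m ≤ (D ω).card ∧ ∀ i, ω i ∉ D ω).filter
        fun ω => (fun i : I => ω i) = fun i : I => ω0 i) ⊆
        Fintype.piFinset fun i => if i ∈ I then {ω0 i} else (D ω0)ᶜ := by
      intro ω hω
      simp only [Finset.mem_filter, Finset.mem_univ, true_and] at hω
      obtain ⟨⟨-, h3⟩, h4⟩ := hω
      have h5 : ∀ i ∈ I, ω i = ω0 i := fun i hi => congrFun h4 ⟨i, hi⟩
      rw [Fintype.mem_piFinset]
      intro i
      split_ifs with hi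
      · simp [h5 i hi]
      · rw [Finset.mem_compl, ← hD ω ω0 h5]
        exact h3 i
    refine (Nat.cast_le.2 (Finset.card_le_card hsub)).trans ?_
    have hcompl : ((D ω0)ᶜ.card : ℝ) ≤ (1 - q) * m := by
      rw [Finset.card_compl, Nat.cast_sub (Finset.card_le_univ _)]
      linarith
    rw [Fintype.card_piFinset]
    push_cast
    have : ∀ i, (((if i ∈ I then {ω0 i} else (D ω0)ᶜ : Finset J).card : ℕ) : ℝ) =
        if i ∈ I then 1 else ((D ω0)ᶜ.card : ℝ) := fun i => by split_ifs <;> simp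
    rw [Finset.prod_congr rfl fun i _ => this i, Finset.prod_ite, Finset.prod_const_one, one_mul,
      Finset.prod_const]
    have hc : (Finset.univ.filter fun i => i ∉ I).card = s - I.card := by
      have : (Finset.univ.filter fun i => i ∉ I) = Iᶜ := by ext; simp
      rw [this, Finset.card_compl, Fintype.card_fin]
    rw [hc]
    exact pow_le_pow_left₀ (Nat.cast_nonneg _) hcompl _
  · rw [Finset.card_univ, Fintype.card_fun, Fintype.card_coe, nsmul_eq_mul, mul_pow, ← hm]
    push_cast
    have h1 : (m : ℝ) ^ s = (m : ℝ) ^ I.card * (m : ℝ) ^ (s - I.card) := by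
      rw [← pow_add]; congr 1; lia
    rw [h1]
    have h2 : (1 - q) ^ (s - I.card) ≤ (1 - q) ^ (s - k) :=
      pow_le_pow_of_le_one (by linarith) (by linarith) (by lia)
    have : 0 ≤ (m : ℝ) ^ I.card * (m : ℝ) ^ (s - I.card) := by positivity
    nlinarith

/-- A vertex is cut out by boundedly many members of the arrangement. -/
theorem IsVertex.exists_fin {ι V : Type*} [AddCommGroup V] [Module ℝ V] [FiniteDimensional ℝ V]
    {g : ι → Dual ℝ V} {v : V} (hv : IsVertex g v) {k : ℕ} (hk : finrank ℝ V = k) :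
    ∃ τ : Fin k → Option ι,
      IsVertex (fun i => (τ i).elim 0 g) v ∧ ∀ i, (τ i).elim 0 g v = 0 := by
  classical
  obtain ⟨r, hr, φ, hφ, hspan⟩ : ∃ r ≤ k, ∃ φ : Fin r → Dual ℝ V,
      (∀ i, ∃ j, g j v = 0 ∧ g j = φ i) ∧ Submodule.span ℝ (Set.range φ) =
        Submodule.span ℝ {ψ : Dual ℝ V | ∃ i, g i v = 0 ∧ g i = ψ} := by
    obtain ⟨φ, hφ, hspan, -⟩ := Submodule.exists_fun_fin_finrank_span_eq ℝ
      {ψ : Dual ℝ V | ∃ i, g i v = 0 ∧ g i = ψ}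
    refine ⟨_, ?_, φ, hφ, hspan⟩
    rw [← hk, ← Subspace.dual_finrank_eq]
    exact Submodule.finrank_le _
  choose a ha using hφ
  refine ⟨fun i => if h : i.1 < r then some (a ⟨i, h⟩) else none, ⟨hv.1, fun w hw => ?_⟩, ?_⟩
  · refine hv.2 w fun i hi => ?_
    have h1 : g i ∈ Submodule.span ℝ (Set.range φ) := by
      rw [hspan]
      exact Submodule.subset_span ⟨i, hi, rfl⟩
    have h2 : Submodule.span ℝ (Set.range φ) ≤ LinearMap.ker (Dual.eval ℝ V w) := by
      rw [Submodule.span_le]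
      rintro _ ⟨j, rfl⟩
      have := hw ⟨j, j.2.trans_le hr⟩
      simp only [j.2, dif_pos, Option.elim_some] at this
      rw [← (ha j).2]
      exact this (ha j).1
    exact h2 h1
  · intro i
    by_cases h : i.1 < r
    · simp only [h, dif_pos, Option.elim_some]
      exact (ha _).1
    · simp [h]

/-- The representative of a vertex line is a function of the cutting functionals only, so the set of
functionals separating two vertices depends only on the sample entries defining them. -/
theorem exists_line_choice (κ V : Type*) [AddCommGroup V] [Module ℝ V] :
    ∃ u : (κ → Dual ℝ V) → V, ∀ φ v, IsVertex φ v → (∀ i, φ i v = 0) →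
      ∃ c : ℝ, c ≠ 0 ∧ v = c • u φ := by
  have : ∀ φ : κ → Dual ℝ V, ∃ u : V, ∀ v, IsVertex φ v → (∀ i, φ i v = 0) →
      ∃ c : ℝ, c ≠ 0 ∧ v = c • u := by
    intro φ
    by_cases h : ∃ u, IsVertex φ u ∧ ∀ i, φ i u = 0
    · obtain ⟨u, hu, -⟩ := h
      refine ⟨u, fun v hv hv0 => ?_⟩
      obtain ⟨c, rfl⟩ := hu.2 v (fun i _ => hv0 i)
      exact ⟨c, by rintro rfl; exact hv.1 (zero_smul _ _), rfl⟩
    · exact ⟨0, fun v h1 h2 => absurd ⟨v, h1, h2⟩ h⟩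
  choose u hu using this
  exact ⟨u, hu⟩

open Classical in
/-- Some sample of size `s` separates every pair of vertices of its arrangement that is separated
by a `q`-fraction of the functionals. -/
theorem exists_separating_sample {J ι₀ V : Type*} [Fintype J] [Nonempty J] [Fintype ι₀]
    [AddCommGroup V] [Module ℝ V] [FiniteDimensional ℝ V] (f : J → Dual ℝ V) (e : ι₀ → Dual ℝ V)
    {s k : ℕ} (hk : finrank ℝ V = k) {q : ℝ} (hq0 : 0 ≤ q) (hq1 : q ≤ 1)
    (h : 2 * ((s : ℝ) + Fintype.card ι₀ + 1) ^ (2 * k) * (1 - q) ^ (s - 2 * k) < 1) :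
    ∃ ω : Fin s → J, ∀ v w, IsVertex (Sum.elim (f ∘ ω) e) v → IsVertex (Sum.elim (f ∘ ω) e) w →
      Conform (Sum.elim (f ∘ ω) e) v w →
      ((Finset.univ.filter fun j => f j v * f j w < 0).card : ℝ) ≤ q * Fintype.card J := by
  obtain ⟨u, hu⟩ := exists_line_choice (Fin k) V
  let ψ : (Fin s → J) → Option (Fin s ⊕ ι₀) → Dual ℝ V :=
    fun ω l => l.elim 0 (Sum.elim (f ∘ ω) e)
  -- Chosen representatives match the actual vertices only up to nonzero scalars. The Boolean
  -- records the sign of the product of the two scalars and costs the factor 2 in the union bound.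
  let D : (Fin k ⊕ Fin k → Option (Fin s ⊕ ι₀)) → Bool → (Fin s → J) → Finset J := fun τ b ω =>
    Finset.univ.filter fun j => (if b then 1 else -1 : ℝ) *
      (f j (u fun i => ψ ω (τ (Sum.inl i))) * f j (u fun i => ψ ω (τ (Sum.inr i)))) < 0
  let bad : (Fin k ⊕ Fin k → Option (Fin s ⊕ ι₀)) × Bool → Finset (Fin s → J) := fun p =>
    Finset.univ.filter fun ω => q * Fintype.card J ≤ (D p.1 p.2 ω).card ∧ ∀ i, ω i ∉ D p.1 p.2 ω
  have hbad : ∀ p, ((bad p).card : ℝ) ≤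
      (Fintype.card J : ℝ) ^ s * (1 - q) ^ (s - 2 * k) := by
    rintro ⟨τ, b⟩
    refine card_samples_missing_le (Finset.univ.biUnion fun i => Finset.univ.filter
      fun a : Fin s => τ i = some (Sum.inl a)) ?_ (D τ b) ?_ hq0 hq1
    · refine (Finset.card_biUnion_le_card_mul _ _ 1 fun i _ => ?_).trans
        (by simp [two_mul])
      rw [Finset.card_le_one]
      intro a ha b hb
      simp only [Finset.mem_filter, Finset.mem_univ, true_and] at ha hb
      rw [ha] at hb
      simpa using hb
    · intro ω ω' hω
      have : ∀ i, ψ ω (τ i) = ψ ω' (τ i) := by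
        intro i
        rcases hi : τ i with _ | a | c
        · rfl
        · have := hω a (Finset.mem_biUnion.2 ⟨i, Finset.mem_univ _, by simp [hi]⟩)
          simp [ψ, this]
        · rfl
      simp only [D, this]
  obtain ⟨ω, hω⟩ : ∃ ω, ω ∉ Finset.univ.biUnion bad := by
    by_contra! hall
    have h1 : (Fintype.card J : ℝ) ^ s ≤ ∑ p, ((bad p).card : ℝ) := by
      have h2 : (Finset.univ.biUnion bad) = Finset.univ := Finset.eq_univ_of_forall hall
      have h3 : Fintype.card (Fin s → J) ≤ ∑ p, (bad p).card := by
        rw [← Finset.card_univ, ← h2]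
        exact Finset.card_biUnion_le
      rw [Fintype.card_fun, Fintype.card_fin] at h3
      exact_mod_cast h3
    have h2 := h1.trans (Finset.sum_le_card_nsmul _ _ _ fun p _ => hbad p)
    rw [Finset.card_univ, nsmul_eq_mul] at h2
    simp only [Fintype.card_prod, Fintype.card_fun, Fintype.card_option, Fintype.card_sum,
      Fintype.card_fin, Fintype.card_bool, ← two_mul] at h2
    push_cast at h2
    have h3 : (0 : ℝ) < (Fintype.card J : ℝ) ^ s := by
      have : 0 < Fintype.card J := Fintype.card_pos
      positivity
    nlinarith
  refine ⟨ω, fun v w hv hw hvw => ?_⟩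
  obtain ⟨τ₁, hv1, hv2⟩ := hv.exists_fin hk
  obtain ⟨τ₂, hw1, hw2⟩ := hw.exists_fin hk
  obtain ⟨c₁, hc₁, h₁⟩ := hu _ v hv1 hv2
  obtain ⟨c₂, hc₂, h₂⟩ := hu _ w hw1 hw2
  by_contra! hlt
  apply hω
  refine Finset.mem_biUnion.2 ⟨(Sum.elim τ₁ τ₂, decide (0 < c₁ * c₂)), Finset.mem_univ _, ?_⟩
  have hD : D (Sum.elim τ₁ τ₂) (decide (0 < c₁ * c₂)) ω =
      Finset.univ.filter fun j => f j v * f j w < 0 := by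
    refine Finset.filter_congr fun j _ => ?_
    have h3 : f j v * f j w = (c₁ * c₂) *
        (f j (u fun i => ψ ω (Sum.elim τ₁ τ₂ (Sum.inl i))) *
          f j (u fun i => ψ ω (Sum.elim τ₁ τ₂ (Sum.inr i)))) := by
      conv_lhs => rw [h₁, h₂]
      simp only [map_smul, smul_eq_mul, Sum.elim_inl, Sum.elim_inr, ψ]
      ring
    rw [h3]
    rcases lt_or_gt_of_ne (mul_ne_zero hc₁ hc₂) with hc | hc
    · simp only [not_lt.2 hc.le, decide_false, Bool.false_eq_true, if_false, neg_mul, one_mul,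
        neg_lt_zero]
      exact ⟨fun h => mul_neg_of_neg_of_pos hc h, fun h => pos_of_mul_neg_right h hc.le⟩
    · simp only [hc, decide_true, if_true, one_mul]
      exact ⟨fun h => mul_neg_of_pos_of_neg hc h, fun h => neg_of_mul_neg_right h hc.le⟩
  simp only [bad, Finset.mem_filter, Finset.mem_univ, true_and, hD]
  -- A sampled functional cannot strictly separate two vertices of one closed cell of the sample.
  refine ⟨hlt.le, fun i hi => ?_⟩
  have := hvw (Sum.inl i)
  simp only [Sum.elim_inl, Function.comp_apply] at this
  linarith

/-! ### Weak cuttings -/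

theorem IsGeneric.conform {ι V : Type*} [AddCommGroup V] [Module ℝ V] {g : ι → Dual ℝ V}
    {y v w : V} (hy : IsGeneric g y) (hv : Conform g v y) (hw : Conform g w y) :
    Conform g v w := by
  intro i
  by_cases hi : g i = 0
  · simp [hi]
  have h1 := hv i
  have h2 := hw i
  have h3 := mul_self_pos.2 (hy i hi)
  by_contra! h4
  nlinarith [mul_nonneg h1 h2]

open Classical in
/-- A weak cutting: a partition into few classes, each crossed by few hyperplanes. -/
theorem exists_cutting_linear {J V : Type*} [Fintype J] [Nonempty J] [AddCommGroup V] [Module ℝ V]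
    [FiniteDimensional ℝ V] {n : ℕ} (hV : finrank ℝ V = n + 1) (f : J → Dual ℝ V) {s : ℕ} {q : ℝ}
    (hq0 : 0 ≤ q) (hq1 : q ≤ 1)
    (h : 2 * ((s : ℝ) + (n + 1) + 1) ^ (2 * (n + 1)) * (1 - q) ^ (s - 2 * (n + 1)) < 1) :
    ∃ (𝒰 : Finset (Finset V)) (c : V → Finset V),
      𝒰.card ≤ 2 ^ (n + 1) * (2 * (2 * (s + (n + 1))) ^ n) ∧ (∀ x, c x ∈ 𝒰) ∧
      ∀ U, ((Finset.univ.filter fun j =>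
        (∃ x, c x = U ∧ f j x = 0) ∧ ∃ x, c x = U ∧ f j x ≠ 0).card : ℝ) ≤
          (n + 1) ^ 2 * (q * Fintype.card J) := by
  let b := finBasis ℝ V
  -- The coordinate functionals are added so that the arrangement has trivial common kernel.
  obtain ⟨ω, hω⟩ := exists_separating_sample (s := s) f (fun i => b.coord i) hV hq0 hq1
    (by simpa [hV] using h)
  set g : Fin s ⊕ Fin (finrank ℝ V) → Dual ℝ V := Sum.elim (f ∘ ω) fun i => b.coord i with hg
  obtain ⟨𝒯, hcard, h𝒯⟩ := exists_triangulation n V hV g (fun x hx =>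
    (b.forall_coord_eq_zero_iff).1 fun i => hx (Sum.inr i))
  have hU : ∀ x, ∃ U : Finset V, (∃ p ∈ 𝒯, p.2.card ≤ n + 1 ∧ U ⊆ p.2) ∧
      (∀ v ∈ U, ∀ w ∈ U, IsVertex g v ∧ IsVertex g w ∧ Conform g v w) ∧
      ∃ t : V → ℝ, (∀ v ∈ U, 0 < t v) ∧ x = ∑ v ∈ U, t v • v := by
    intro x
    obtain ⟨y, hy, hxy⟩ := exists_generic_conform g x
    obtain ⟨T, hT, hTc, hTv, t, ht, hx⟩ := h𝒯 y hy x hxy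
    -- Dropping zero coefficients leaves the face with `x` in its relative interior; its at most `2
    -- ^ (n + 1)` choices per cone enter the count.
    refine ⟨T.filter fun v => 0 < t v, ⟨_, hT, hTc, Finset.filter_subset _ _⟩, ?_, t, ?_, ?_⟩
    · intro v hv w hw
      have hv' := hTv v (Finset.mem_filter.1 hv).1
      have hw' := hTv w (Finset.mem_filter.1 hw).1
      exact ⟨hv'.1, hw'.1, hy.conform hv'.2 hw'.2⟩
    · exact fun v hv => (Finset.mem_filter.1 hv).2
    · rw [hx, Finset.sum_filter_of_ne]
      intro v _ hv0
      exact lt_of_le_of_ne (ht v) fun h => hv0 (by rw [← h, zero_smul])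
  choose c hc1 hc2 hc3 using hU
  refine ⟨(𝒯.filter fun p => p.2.card ≤ n + 1).biUnion fun p => p.2.powerset, c, ?_, ?_, ?_⟩
  · have hcι : Fintype.card (Fin s ⊕ Fin (finrank ℝ V)) = s + (n + 1) := by simp [hV]
    rw [hcι] at hcard
    refine (Finset.card_biUnion_le_card_mul _ _ (2 ^ (n + 1)) fun p hp => ?_).trans ?_
    · rw [Finset.card_powerset]
      exact Nat.pow_le_pow_right (by norm_num) (Finset.mem_filter.1 hp).2
    · rw [mul_comm]
      exact Nat.mul_le_mul le_rfl ((Finset.card_filter_le _ _).trans hcard)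
  · intro x
    obtain ⟨p, hp, hpc, hpU⟩ := hc1 x
    exact Finset.mem_biUnion.2 ⟨p, Finset.mem_filter.2 ⟨hp, hpc⟩, Finset.mem_powerset.2 hpU⟩
  · intro U
    by_cases hne : ∃ x, c x = U
    swap
    · rw [Finset.filter_false_of_mem]
      · simp only [Finset.card_empty, Nat.cast_zero]; positivity
      · rintro j - ⟨⟨x, hx, -⟩, -⟩
        exact hne ⟨x, hx⟩
    obtain ⟨x₀, rfl⟩ := hne
    have hUc : (c x₀).card ≤ n + 1 := by
      obtain ⟨p, -, hpc, hpU⟩ := hc1 x₀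
      exact (Finset.card_le_card hpU).trans hpc
    have hsub : (Finset.univ.filter fun j =>
        (∃ x, c x = c x₀ ∧ f j x = 0) ∧ ∃ x, c x = c x₀ ∧ f j x ≠ 0) ⊆
        (c x₀ ×ˢ c x₀).biUnion fun p => Finset.univ.filter fun j => f j p.1 * f j p.2 < 0 := by
      intro j hj
      simp only [Finset.mem_filter, Finset.mem_univ, true_and] at hj
      obtain ⟨⟨x, hx, hx0⟩, x', hx', hx0'⟩ := hj
      by_contra hcon
      have hnn : ∀ v ∈ c x₀, ∀ w ∈ c x₀, 0 ≤ f j v * f j w := by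
        intro v hv w hw
        by_contra! hlt
        exact hcon (Finset.mem_biUnion.2 ⟨(v, w), Finset.mem_product.2 ⟨hv, hw⟩, by simpa⟩)
      -- Without strictly separated vertices, a vanishing positive combination has only vanishing
      -- terms.
      have hzero : ∀ v ∈ c x₀, f j v = 0 := by
        intro v hv
        obtain ⟨t, ht, hxt⟩ := hc3 x
        rw [hx] at ht hxt
        have h1 : ∑ w ∈ c x₀, t w * (f j v * f j w) = 0 := by
          have : f j v * f j x = 0 := by rw [hx0, mul_zero]
          rw [hxt, map_sum, Finset.mul_sum] at this
          rw [← this]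
          refine Finset.sum_congr rfl fun w _ => ?_
          simp only [map_smul, smul_eq_mul]; ring
        rw [Finset.sum_eq_zero_iff_of_nonneg fun w hw =>
          mul_nonneg (ht w hw).le (hnn v hv w hw)] at h1
        exact mul_self_eq_zero.1 ((mul_eq_zero.1 (h1 v hv)).resolve_left (ht v hv).ne')
      obtain ⟨t, -, hxt⟩ := hc3 x'
      rw [hx'] at hxt
      apply hx0'
      rw [hxt, map_sum]
      exact Finset.sum_eq_zero fun w hw => by rw [map_smul, hzero w hw, smul_zero]
    have h1 : (((c x₀ ×ˢ c x₀).biUnion fun p =>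
        Finset.univ.filter fun j => f j p.1 * f j p.2 < 0).card : ℝ) ≤
        ∑ p ∈ c x₀ ×ˢ c x₀, q * Fintype.card J := by
      refine (Nat.cast_le.2 Finset.card_biUnion_le).trans ?_
      push_cast
      refine Finset.sum_le_sum fun p hp => ?_
      obtain ⟨hp1, hp2⟩ := Finset.mem_product.1 hp
      obtain ⟨h2, h3, h4⟩ := hc2 x₀ _ hp1 _ hp2
      exact hω _ _ h2 h3 h4
    refine (Nat.cast_le.2 (Finset.card_le_card hsub)).trans (h1.trans ?_)
    rw [Finset.sum_const, nsmul_eq_mul, Finset.card_product]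
    have h2 : ((c x₀).card : ℝ) ≤ n + 1 := by exact_mod_cast hUc
    have h3 : (((c x₀).card * (c x₀).card : ℕ) : ℝ) ≤ (n + 1) ^ 2 := by
      push_cast; rw [sq]; exact mul_self_le_mul_self (Nat.cast_nonneg _) h2
    exact mul_le_mul_of_nonneg_right h3 (by positivity)

/-- With `R = s ^ (1 - η)`, the budget `R ^ (n + δ)` equals `s ^ (n + δ / 2)` and beats the `O(s ^
n)` cones, while the failure probability is at most a power of `s` times `exp (-b * s ^ η)`. A large
`s` satisfies both. -/
theorem exists_cutting_parameters (n : ℕ) {δ : ℝ} (hδ : 0 < δ) :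
    ∃ (s : ℕ) (R : ℝ), 2 ≤ R ∧
      (2 : ℝ) ^ (n + 1) * (2 * (2 * ((s : ℝ) + (n + 1))) ^ n) ≤ R ^ ((n : ℝ) + δ) ∧
      2 * ((s : ℝ) + (n + 1) + 1) ^ (2 * (n + 1)) *
        (1 - 1 / (R * (n + 1) ^ 2)) ^ (s - 2 * (n + 1)) < 1 := by
  have hnδ : 0 < (n : ℝ) + δ := by positivity
  set η : ℝ := δ / (2 * (n + δ)) with hη
  have hη0 : 0 < η := by positivity
  have hη1 : 0 < 1 - η := by
    rw [hη, sub_pos, div_lt_one (by positivity)]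
    have : (0 : ℝ) ≤ n := Nat.cast_nonneg n
    linarith
  have hexp : (1 - η) * (n + δ) = n + δ / 2 := by rw [hη]; field_simp; ring
  set k := 2 * (n + 1) with hk
  set b : ℝ := 1 / (2 * (n + 1) ^ 2) with hb
  have hb0 : 0 < b := by positivity
  have t1 : Filter.Tendsto (fun s : ℕ => (s : ℝ) ^ (1 - η)) Filter.atTop Filter.atTop :=
    (tendsto_rpow_atTop hη1).comp tendsto_natCast_atTop_atTop
  have t2 : Filter.Tendsto (fun s : ℕ => (s : ℝ) ^ (δ / 2)) Filter.atTop Filter.atTop :=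
    (tendsto_rpow_atTop (by positivity)).comp tendsto_natCast_atTop_atTop
  have t3 : Filter.Tendsto (fun s : ℕ => (s : ℝ) ^ η) Filter.atTop Filter.atTop :=
    (tendsto_rpow_atTop hη0).comp tendsto_natCast_atTop_atTop
  have t4 := (tendsto_rpow_mul_exp_neg_mul_atTop_nhds_zero (k / η) b hb0).comp t3
  have e4 := t4.eventually (gt_mem_nhds (show (0 : ℝ) < 1 / (2 * 2 ^ k) by positivity))
  obtain ⟨s, h1, h2, h3, h4⟩ := ((t1.eventually_ge_atTop 2).and
    ((t2.eventually_ge_atTop (2 ^ (n + 2) * 4 ^ n)).and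
      (e4.and (Filter.eventually_ge_atTop (2 * k))))).exists
  have hs0 : 0 < (s : ℝ) := by
    have : 0 < s := by lia
    exact_mod_cast this
  have hsk : (2 * k : ℝ) ≤ s := by exact_mod_cast h4
  have hkn : (k : ℝ) = 2 * (n + 1) := by rw [hk]; push_cast; ring
  have hn0 : (0 : ℝ) ≤ n := Nat.cast_nonneg n
  refine ⟨s, (s : ℝ) ^ (1 - η), h1, ?_, ?_⟩
  · rw [← Real.rpow_mul hs0.le, hexp, Real.rpow_add hs0, Real.rpow_natCast]
    calc (2 : ℝ) ^ (n + 1) * (2 * (2 * ((s : ℝ) + (n + 1))) ^ n)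
        ≤ (2 : ℝ) ^ (n + 1) * (2 * (2 * (2 * (s : ℝ))) ^ n) := by gcongr; linarith
      _ = (s : ℝ) ^ n * (2 ^ (n + 2) * 4 ^ n) := by
          rw [← mul_assoc 2 2 (s : ℝ), mul_pow]; norm_num; ring
      _ ≤ (s : ℝ) ^ n * (s : ℝ) ^ (δ / 2) := by gcongr
  · set R := (s : ℝ) ^ (1 - η) with hR
    set q := 1 / (R * (n + 1) ^ 2) with hq
    have hR0 : 0 < R := by linarith
    have hq1 : q ≤ 1 := by
      rw [hq, div_le_one (by positivity)]
      nlinarith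
    have hqs : q * (s / 2) = b * (s : ℝ) ^ η := by
      have : (s : ℝ) = R * (s : ℝ) ^ η := by
        rw [hR, ← Real.rpow_add hs0]; simp
      rw [hq, hb]
      nth_rw 1 [this]
      field_simp
    have hpow : (1 - q) ^ (s - k) ≤ Real.exp (-b * (s : ℝ) ^ η) := by
      calc (1 - q) ^ (s - k) ≤ (Real.exp (-q)) ^ (s - k) :=
            pow_le_pow_left₀ (by linarith) (by linarith [Real.add_one_le_exp (-q)]) _
        _ = Real.exp (-(q * (s - k : ℕ))) := by rw [← Real.exp_nat_mul]; ring_nf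
        _ ≤ Real.exp (-(q * (s / 2))) := by
            have h5 : (s : ℝ) / 2 ≤ (s - k : ℕ) := by
              rw [Nat.cast_sub (by lia)]; linarith
            have h6 : 0 ≤ q := by positivity
            gcongr
        _ = _ := by rw [hqs]; ring_nf
    have hsx : ((s : ℝ) ^ η) ^ ((k : ℝ) / η) = (s : ℝ) ^ k := by
      rw [← Real.rpow_mul hs0.le, mul_div_cancel₀ _ hη0.ne', Real.rpow_natCast]
    simp only [Function.comp_apply, hsx] at h3
    calc 2 * ((s : ℝ) + (n + 1) + 1) ^ k * (1 - q) ^ (s - k)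
        ≤ 2 * (2 * (s : ℝ)) ^ k * Real.exp (-b * (s : ℝ) ^ η) := by
          have : 0 ≤ 1 - q := by linarith
          gcongr
          linarith
      _ = 2 * 2 ^ k * ((s : ℝ) ^ k * Real.exp (-b * (s : ℝ) ^ η)) := by rw [mul_pow]; ring
      _ < 2 * 2 ^ k * (1 / (2 * 2 ^ k)) := by gcongr
      _ = 1 := by field_simp

/-! ### Counting incidences by iterated cuttings -/

namespace PointHyperplane

theorem incidences_eq_sum {X : Type*} (P : Finset X) (H : Finset (Set X)) [∀ h : Set X,
    DecidablePred (· ∈ h)] : incidences P H = ∑ h ∈ H, (P.filter fun p => p ∈ h).card := by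
  classical
  rw [incidences, Finset.card_filter, Finset.sum_product_right]
  refine Finset.sum_congr rfl fun h _ => ?_
  rw [Finset.card_filter]
  exact Finset.sum_congr rfl fun p _ => by congr

theorem incidences_le_mul {X : Type*} (P : Finset X) (H : Finset (Set X)) :
    incidences P H ≤ P.card * H.card := by
  classical
  rw [incidences, ← Finset.card_product]
  exact Finset.card_filter_le _ _

open Classical in
/-- The points of `P` lying on some but not all members of `H`. -/
noncomputable def crossingPoints {X : Type*} (P : Finset X) (H : Finset (Set X)) : Finset X :=
  P.filter fun p => (∃ h ∈ H, p ∈ h) ∧ ∃ h ∈ H, p ∉ h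

theorem incidences_le_crossing_add_shared {X : Type*} (P : Finset X) (H : Finset (Set X)) :
    incidences P H ≤ incidences (crossingPoints P H) H + incidences (sharedPoints P H) H := by
  classical
  simp only [incidences_eq_sum]
  rw [← Finset.sum_add_distrib]
  refine Finset.sum_le_sum fun h hh => ?_
  refine (Finset.card_le_card ?_).trans (Finset.card_union_le _ _)
  intro p hp
  rw [Finset.mem_filter] at hp
  simp only [Finset.mem_union, Finset.mem_filter, crossingPoints, sharedPoints]
  by_cases hall : ∀ h ∈ H, p ∈ h
  · exact Or.inr ⟨⟨hp.1, hall⟩, hp.2⟩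
  · push Not at hall
    exact Or.inl ⟨⟨hp.1, ⟨h, hh, hp.2⟩, hall⟩, hp.2⟩

theorem sharedPoints_mono {X : Type*} {P P' : Finset X} (h : P' ⊆ P) (S : Finset (Set X)) :
    sharedPoints P' S ⊆ sharedPoints P S := by
  classical
  exact Finset.filter_subset_filter _ h

/-- Either there are fewer than `γ` hyperplanes, or fewer than `γ` points are shared. -/
theorem incidences_sharedPoints_le {X : Type*} (P : Finset X) (H : Finset (Set X)) {γ : ℝ}
    (hγ : 0 ≤ γ) (hb : γ ≤ (H.card : ℝ) → ((sharedPoints P H).card : ℝ) < γ) :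
    (incidences (sharedPoints P H) H : ℝ) ≤ γ * H.card + γ * P.card := by
  classical
  have h1 : (incidences (sharedPoints P H) H : ℝ) ≤ (sharedPoints P H).card * H.card := by
    exact_mod_cast incidences_le_mul _ _
  refine h1.trans ?_
  have h2 : ((sharedPoints P H).card : ℝ) ≤ P.card := by
    exact_mod_cast Finset.card_filter_le _ _
  have h3 : (0 : ℝ) ≤ (sharedPoints P H).card := Nat.cast_nonneg _
  have h4 : (0 : ℝ) ≤ H.card := Nat.cast_nonneg _
  rcases le_or_gt γ (H.card : ℝ) with h | h
  · have := mul_le_mul_of_nonneg_right (hb h).le h4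
    nlinarith
  · have := mul_le_mul h2 h.le h4 (Nat.cast_nonneg _)
    nlinarith

open Classical in
/-- Iterating cuttings `j` times. -/
theorem incidences_le_of_cuttings {X L : Type*} {Q : Set X → Prop} {K : ℕ} {R M θ γ : ℝ}
    (hR : 1 ≤ R) (hM : 2 ≤ M) (hK : (K : ℝ) ≤ R * M) (hθ : 0 ≤ θ) (hγ : 0 ≤ γ)
    (hcut : ∀ (P : Finset X) (H : Finset (Set X)), (∀ h ∈ H, Q h) →
      ∃ (𝒰 : Finset L) (c : Set X → L), 𝒰.card ≤ K ∧ (∀ h ∈ H, c h ∈ 𝒰) ∧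
        ∀ U, ((crossingPoints P (H.filter fun h => c h = U)).card : ℝ) ≤ P.card / R)
    (j : ℕ) : ∀ (P : Finset X) (H : Finset (Set X)), (∀ h ∈ H, Q h) →
      (∀ P' ⊆ P, ∀ H' ⊆ H, (incidences P' H' : ℝ) ≤
        γ * ((P'.card : ℝ) + (H'.card : ℝ) * (P'.card : ℝ) ^ θ)) →
      (∀ S ⊆ H, γ ≤ (S.card : ℝ) → ((sharedPoints P S).card : ℝ) < γ) →
      (incidences P H : ℝ) ≤ γ * (j * H.card + P.card * ((1 + R * M) * M ^ j - R * M) +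
        H.card * (P.card / R ^ j) ^ θ) := by
  induction j with
  | zero =>
    intro P H _ ha _
    have := ha P subset_rfl H subset_rfl
    simpa using this
  | succ j ih =>
    intro P H hQ ha hb
    obtain ⟨𝒰, c, hcard, hmem, hcr⟩ := hcut P H hQ
    set HU : L → Finset (Set X) := fun U => H.filter fun h => c h = U with hHU
    have hsubH : ∀ U, HU U ⊆ H := fun U => Finset.filter_subset _ _
    have hsubP : ∀ U, crossingPoints P (HU U) ⊆ P := fun U => Finset.filter_subset _ _
    set B : ℝ := (1 + R * M) * M ^ j - R * M with hB
    have hB0 : 0 ≤ B := by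
      have : 1 ≤ M ^ j := one_le_pow₀ (by linarith)
      have h2 : 0 ≤ R * M := by positivity
      nlinarith
    have hsplit : (incidences P H : ℝ) = ∑ U ∈ 𝒰, (incidences P (HU U) : ℝ) := by
      rw [← Nat.cast_sum]
      congr 1
      simp only [incidences_eq_sum, hHU]
      exact (Finset.sum_fiberwise_of_maps_to hmem _).symm
    have hcardH : (H.card : ℝ) = ∑ U ∈ 𝒰, ((HU U).card : ℝ) := by
      rw [← Nat.cast_sum]
      congr 1
      exact Finset.card_eq_sum_card_fiberwise hmem
    have hterm : ∀ U ∈ 𝒰, (incidences P (HU U) : ℝ) ≤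
        γ * (((j + 1 : ℕ) : ℝ) + (P.card / R ^ (j + 1)) ^ θ) * (HU U).card +
          γ * (P.card + P.card / R * B) := by
      intro U _
      have h1 : (incidences P (HU U) : ℝ) ≤ incidences (crossingPoints P (HU U)) (HU U) +
          incidences (sharedPoints P (HU U)) (HU U) := by
        exact_mod_cast incidences_le_crossing_add_shared P (HU U)
      have h2 := incidences_sharedPoints_le P (HU U) hγ (hb _ (hsubH U))
      have h3 := ih (crossingPoints P (HU U)) (HU U) (fun h hh => hQ h (hsubH U hh))
        (fun P' hP' H' hH' => ha P' (hP'.trans (hsubP U)) H' (hH'.trans (hsubH U)))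
        (fun S hS hγS => lt_of_le_of_lt
          (Nat.cast_le.2 (Finset.card_le_card (sharedPoints_mono (hsubP U) S)))
          (hb S (hS.trans (hsubH U)) hγS))
      have h4 : (((crossingPoints P (HU U)).card : ℝ) / R ^ j) ^ θ ≤
          ((P.card : ℝ) / R ^ (j + 1)) ^ θ := by
        refine Real.rpow_le_rpow (by positivity) ?_ hθ
        rw [pow_succ', ← div_div]
        gcongr
        exact hcr U
      have h5 := mul_le_mul_of_nonneg_right (hcr U) hB0
      have h6 := mul_le_mul_of_nonneg_left h4 (Nat.cast_nonneg (α := ℝ) (HU U).card)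
      have h7 := h3.trans (mul_le_mul_of_nonneg_left (add_le_add (add_le_add_right h5 _) h6) hγ)
      push_cast
      linarith
    rw [hsplit]
    refine (Finset.sum_le_sum hterm).trans ?_
    rw [Finset.sum_add_distrib, ← Finset.mul_sum, ← hcardH, Finset.sum_const, nsmul_eq_mul]
    -- The coefficient `B` of `P.card` becomes at most `R * M + M * B` in one round; the closed form
    -- dominates this recursion because `2 ≤ M`.
    have hKB : (𝒰.card : ℝ) * (P.card + P.card / R * B) ≤
        P.card * ((1 + R * M) * M ^ (j + 1) - R * M) := by
      have h1 : (𝒰.card : ℝ) ≤ R * M := le_trans (by exact_mod_cast hcard) hK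
      refine (mul_le_mul_of_nonneg_right h1 (by positivity)).trans ?_
      have h2 : R * M * ((P.card : ℝ) + P.card / R * B) = P.card * (R * M + M * B) := by
        field_simp
      rw [h2]
      refine mul_le_mul_of_nonneg_left ?_ (Nat.cast_nonneg _)
      rw [hB, pow_succ']
      have : 0 ≤ R * M * (M - 2) := mul_nonneg (by positivity) (by linarith)
      nlinarith
    have := mul_le_mul_of_nonneg_left hKB hγ
    push_cast at this ⊢
    linarith

theorem exists_cutting {n : ℕ} {δ : ℝ} (hδ : 0 < δ) :
    ∃ (R : ℝ) (K : ℕ), 2 ≤ R ∧ (K : ℝ) ≤ R ^ ((n : ℝ) + δ) ∧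
      ∀ (P : Finset (EuclideanSpace ℝ (Fin n))) (H : Finset (Set (EuclideanSpace ℝ (Fin n)))),
      (∀ h ∈ H, IsHyperplane h) →
      ∃ (𝒰 : Finset (Finset (EuclideanSpace ℝ (Fin n) × ℝ)))
        (c : Set (EuclideanSpace ℝ (Fin n)) → Finset (EuclideanSpace ℝ (Fin n) × ℝ)),
        𝒰.card ≤ K ∧ (∀ h ∈ H, c h ∈ 𝒰) ∧
        ∀ U, ((crossingPoints P (H.filter fun h => c h = U)).card : ℝ) ≤ P.card / R := by
  classical
  obtain ⟨s, R, hR, hK, hq⟩ := exists_cutting_parameters n hδ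
  refine ⟨R, 2 ^ (n + 1) * (2 * (2 * (s + (n + 1))) ^ n), hR, by exact_mod_cast hK, ?_⟩
  intro P H hH
  rcases P.eq_empty_or_nonempty with rfl | hP
  · refine ⟨{∅}, fun _ => ∅, ?_, by simp, fun U => by simp [crossingPoints]⟩
    rw [Finset.card_singleton]
    exact Nat.one_le_iff_ne_zero.2 (by positivity)
  have : Nonempty P := hP.to_subtype
  let f : P → Dual ℝ (EuclideanSpace ℝ (Fin n) × ℝ) := fun p =>
    (innerₗ (EuclideanSpace ℝ (Fin n)) (p : EuclideanSpace ℝ (Fin n))) ∘ₗ LinearMap.fst ℝ _ _ -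
      LinearMap.snd ℝ _ _
  have hx : ∀ h : Set (EuclideanSpace ℝ (Fin n)), ∃ x : EuclideanSpace ℝ (Fin n) × ℝ,
      h ∈ H → ∀ p : P, (p : EuclideanSpace ℝ (Fin n)) ∈ h ↔ f p x = 0 := by
    intro h
    by_cases hh : h ∈ H
    · obtain ⟨a, b, -, rfl⟩ := hH h hh
      refine ⟨(a, b), fun _ p => ?_⟩
      simp [f, sub_eq_zero, real_inner_comm]
    · exact ⟨0, fun h => absurd h hh⟩
  choose x hx using hx
  have hR0 : (0 : ℝ) < R := by linarith
  -- The factor `(n + 1) ^ 2` in `q` absorbs the number of vertex pairs of a face.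
  obtain ⟨𝒰, c, hcard, hmem, hcr⟩ := exists_cutting_linear (n := n) (by simp) f (s := s)
    (q := 1 / (R * (n + 1) ^ 2)) (by positivity) (by
      rw [div_le_one (by positivity)]
      have : (0 : ℝ) ≤ n := Nat.cast_nonneg n
      nlinarith) hq
  refine ⟨𝒰, fun h => c (x h), hcard, fun h _ => hmem _, fun U => ?_⟩
  have h1 := hcr U
  have h2 : ((n : ℝ) + 1) ^ 2 * (1 / (R * (n + 1) ^ 2) * Fintype.card P) = P.card / R := by
    rw [Fintype.card_coe]; field_simp
  rw [h2] at h1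
  refine le_trans (Nat.cast_le.2 ?_) h1
  rw [← Finset.card_map (Function.Embedding.subtype _)]
  refine Finset.card_le_card fun p hp => ?_
  simp only [crossingPoints, Finset.mem_filter] at hp
  obtain ⟨hpP, ⟨h, ⟨hh, hc⟩, hph⟩, h', ⟨hh', hc'⟩, hph'⟩ := hp
  refine Finset.mem_map.2 ⟨⟨p, hpP⟩, ?_, rfl⟩
  simp only [Finset.mem_filter, Finset.mem_univ, true_and]
  exact ⟨⟨x h, hc, (hx h hh ⟨p, hpP⟩).1 hph⟩, x h', hc',
    fun h0 => hph' ((hx h' hh' ⟨p, hpP⟩).2 h0)⟩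

end PointHyperplane

/-! ### Choosing the number of rounds -/

theorem exists_iteration_count {ν ε R : ℝ} (hν : 3 ≤ ν) (hε : 0 < ε) (hR : 2 ≤ R) :
    ∃ C : ℝ, 0 < C ∧ ∀ m N : ℝ, 1 ≤ m → 0 ≤ N → ∃ j : ℕ,
      j * N + m * ((1 + R * R ^ (ν - 1 + ε)) * (R ^ (ν - 1 + ε)) ^ j - R * R ^ (ν - 1 + ε)) +
        N * (m / R ^ j) ^ ((ν - 3) / (ν - 2)) ≤
      C * (m ^ (ν * (ν - 3) / (ν ^ 2 - 2 * ν - 1)) *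
          N ^ ((ν - 1) * (ν - 2) / (ν ^ 2 - 2 * ν - 1) + ε) + m + N * (1 + Real.logb 2 m)) := by
  set θ := (ν - 3) / (ν - 2) with hθ
  set D := ν ^ 2 - 2 * ν - 1 with hD
  set α := ν * (ν - 3) / D with hα
  set β := (ν - 1) * (ν - 2) / D with hβ
  set M := R ^ (ν - 1 + ε) with hM
  have hR0 : 0 < R := by linarith
  have hM0 : 0 < M := by positivity
  have hd : 0 < ν - 2 := by linarith
  have hD0 : 0 < D := by rw [hD]; nlinarith
  have hdD : ν - 2 ≤ D := by rw [hD]; nlinarith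
  have hθ0 : 0 ≤ θ := div_nonneg (by linarith) hd.le
  refine ⟨2 + R * M + R ^ θ, by positivity, fun m N hm hN => ?_⟩
  have hm0 : 0 < m := by linarith
  have hlog : 0 ≤ Real.logb 2 m := Real.logb_nonneg (by norm_num) hm
  set A := m ^ α * N ^ (β + ε) with hA
  have hA0 : 0 ≤ A := by positivity
  have hRM : 0 ≤ R * M := by positivity
  have hRθ : 0 ≤ R ^ θ := by positivity
  -- If `N ^ (ν - 2) ≤ m`, hypothesis (a) alone is enough and no cutting is made.
  rcases le_or_gt (N ^ (ν - 2)) m with hcase | hcase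
  · refine ⟨0, ?_⟩
    have h1 : N ≤ m ^ (1 / (ν - 2)) := by
      rw [one_div, Real.le_rpow_inv_iff_of_pos hN hm0.le hd]
      exact hcase
    have h2 : N * m ^ θ ≤ m := by
      calc N * m ^ θ ≤ m ^ (1 / (ν - 2)) * m ^ θ := by gcongr
        _ = m := by
          rw [← Real.rpow_add hm0]
          have : 1 / (ν - 2) + θ = 1 := by rw [hθ]; field_simp; ring
          rw [this, Real.rpow_one]
    simp only [Nat.cast_zero, zero_mul, pow_zero, mul_one, div_one, zero_add]
    have h3 : m * (1 + R * M - R * M) + N * m ^ θ ≤ 2 * m := by linarith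
    have h4 : 0 ≤ N * (1 + Real.logb 2 m) := by positivity
    nlinarith [mul_nonneg hRM (add_nonneg (add_nonneg hA0 hm0.le) h4),
      mul_nonneg hRθ (add_nonneg (add_nonneg hA0 hm0.le) h4)]
  · have hN1 : 1 < N := by
      by_contra! h
      have := Real.rpow_le_one hN h hd.le
      linarith
    have hN0 : 0 < N := by linarith
    obtain ⟨a, ha⟩ : ∃ a, m = Real.exp a := ⟨_, (Real.exp_log hm0).symm⟩
    obtain ⟨b, hb⟩ : ∃ b, N = Real.exp b := ⟨_, (Real.exp_log hN0).symm⟩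
    have ha0 : 0 ≤ a := by rwa [ha, Real.one_le_exp_iff] at hm
    have hb0 : 0 < b := by rwa [hb, Real.one_lt_exp_iff] at hN1
    have hab : a < b * (ν - 2) := by
      rwa [ha, hb, ← Real.exp_mul, Real.exp_lt_exp] at hcase
    -- This `l = log ρ` solves `m * ρ ^ (ν - 1) = N * (m / ρ) ^ θ`; both sides are then `m ^ α * N ^
    -- β`.
    set l := (b * (ν - 2) - a) / D with hl
    have hl0 : 0 < l := div_pos (by linarith) hD0
    set ρ := Real.exp l with hρ
    have hρ1 : 1 ≤ ρ := Real.one_le_exp hl0.le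
    have hAexp : A = Real.exp (a * α + b * β + b * ε) := by
      rw [hA, ha, hb, ← Real.exp_mul, ← Real.exp_mul, ← Real.exp_add]; ring_nf
    -- The cap at `m` keeps `j ≤ logb 2 m`. When it is active, `m / R ^ j` is at most `R`, so the
    -- last term is `O(N)`.
    obtain ⟨j, hj1, hj2⟩ := exists_nat_pow_near (le_min hρ1 hm) (show 1 < R by linarith)
    refine ⟨j, ?_⟩
    have hjm : R ^ j ≤ m := hj1.trans (min_le_right _ _)
    have hjρ : R ^ j ≤ ρ := hj1.trans (min_le_left _ _)
    have h1 : (j : ℝ) ≤ Real.logb 2 m := by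
      rw [Real.le_logb_iff_rpow_le (by norm_num) hm0, Real.rpow_natCast]
      exact (pow_le_pow_left₀ (by norm_num) hR j).trans hjm
    have h2 : m * M ^ j ≤ A := by
      have : M ^ j = (R ^ j) ^ (ν - 1 + ε) := by
        rw [hM, ← Real.rpow_natCast, ← Real.rpow_natCast, ← Real.rpow_mul hR0.le,
          ← Real.rpow_mul hR0.le, mul_comm]
      rw [this]
      calc m * (R ^ j) ^ (ν - 1 + ε) ≤ m * ρ ^ (ν - 1 + ε) := by
            gcongr; linarith
        _ = Real.exp (a + l * (ν - 1) + l * ε) := by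
            rw [ha, hρ, ← Real.exp_mul, ← Real.exp_add]; ring_nf
        _ ≤ A := by
            rw [hAexp, Real.exp_le_exp]
            have e1 : a + l * (ν - 1) = a * α + b * β := by
              rw [hl, hα, hβ]; field_simp; rw [hD]; ring
            -- Since `ρ ≤ N`, the loss `ρ ^ ε` is absorbed by `N ^ ε`.
            have e2 : l ≤ b := by
              rw [hl, div_le_iff₀ hD0]; nlinarith
            have := mul_le_mul_of_nonneg_right e2 hε.le
            linarith
    have h3 : N * (m / R ^ j) ^ θ ≤ R ^ θ * (N + A) := by
      have h4 : m / R ^ j ≤ R * (m / min ρ m) := by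
        have : 0 < min ρ m := lt_min (by linarith) hm0
        rw [div_le_iff₀ (by positivity)]
        have h5 : R * (m / min ρ m) * R ^ j = m * (R ^ (j + 1) / min ρ m) := by
          rw [pow_succ]; ring
        rw [h5]
        exact le_mul_of_one_le_right hm0.le ((one_le_div this).2 hj2.le)
      have h6 : N * (m / R ^ j) ^ θ ≤ R ^ θ * (N * (m / min ρ m) ^ θ) := by
        have : 0 < min ρ m := lt_min (by linarith) hm0
        calc N * (m / R ^ j) ^ θ ≤ N * (R * (m / min ρ m)) ^ θ := by gcongr
          _ = R ^ θ * (N * (m / min ρ m) ^ θ) := by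
            rw [Real.mul_rpow hR0.le (by positivity)]; ring
      refine h6.trans (mul_le_mul_of_nonneg_left ?_ hRθ)
      rcases min_choice ρ m with h | h
      · rw [h]
        have : N * (m / ρ) ^ θ ≤ A := by
          rw [hAexp, ha, hb, hρ, ← Real.exp_sub, ← Real.exp_mul, ← Real.exp_add, Real.exp_le_exp]
          have e1 : b + (a - l) * θ = a * α + b * β := by
            rw [hl, hα, hβ, hθ]; field_simp; rw [hD]; ring
          have : 0 ≤ b * ε := by positivity
          linarith
        linarith
      · rw [h, div_self hm0.ne', Real.one_rpow, mul_one]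
        linarith
    have h7 := mul_le_mul_of_nonneg_right h1 hN
    have h8 := mul_le_mul_of_nonneg_left h2 (show 0 ≤ 1 + R * M by positivity)
    have h9 : 0 ≤ N * Real.logb 2 m := by positivity
    have p1 := mul_nonneg hRM (add_nonneg (add_nonneg hm0.le hN) h9)
    have p2 := mul_nonneg hRθ (add_nonneg hm0.le h9)
    have p3 := mul_nonneg hRM hm0.le
    have e3 : m * ((1 + R * M) * M ^ j - R * M) = (1 + R * M) * (m * M ^ j) - R * M * m := by ring
    rw [e3]
    nlinarith

theorem mainTheorem7 (n : ℕ) (hn : 3 ≤ n) (ε : ℝ) (hε : 0 < ε) :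
    ∃ C : ℝ, 0 < C ∧
      ∀ (P : Finset (EuclideanSpace ℝ (Fin n)))
        (H : Finset (Set (EuclideanSpace ℝ (Fin n)))) (γ : ℝ),
        (∀ h ∈ H, PointHyperplane.IsHyperplane h) →
        1 ≤ γ →
        (∀ P' ⊆ P, ∀ H' ⊆ H,
          (PointHyperplane.incidences P' H' : ℝ) ≤
            γ * ((P'.card : ℝ) +
              (H'.card : ℝ) * (P'.card : ℝ) ^ (((n : ℝ) - 3) / ((n : ℝ) - 2)))) →
        (∀ S ⊆ H, γ ≤ (S.card : ℝ) →
          ((PointHyperplane.sharedPoints P S).card : ℝ) < γ) →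
        (PointHyperplane.incidences P H : ℝ) ≤
          C * γ *
            ((P.card : ℝ) ^ ((n : ℝ) * ((n : ℝ) - 3) / ((n : ℝ) ^ 2 - 2 * (n : ℝ) - 1)) *
                (H.card : ℝ) ^
                  (((n : ℝ) - 1) * ((n : ℝ) - 2) / ((n : ℝ) ^ 2 - 2 * (n : ℝ) - 1) + ε) +
              (P.card : ℝ) +
              (H.card : ℝ) * (1 + Real.logb 2 (P.card : ℝ))) := by
  classical
  have hn3 : (3 : ℝ) ≤ n := by exact_mod_cast hn
  obtain ⟨R, K, hR, hK, hcut⟩ := PointHyperplane.exists_cutting (n := n) hε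
  obtain ⟨C, hC, hmain⟩ := exists_iteration_count hn3 hε hR
  refine ⟨C, hC, fun P H γ hH hγ ha hb => ?_⟩
  have hγ0 : 0 ≤ γ := by linarith
  rcases P.eq_empty_or_nonempty with rfl | hP
  · have h0 : PointHyperplane.incidences (∅ : Finset (EuclideanSpace ℝ (Fin n))) H = 0 := by
      simpa using PointHyperplane.incidences_le_mul (∅ : Finset (EuclideanSpace ℝ (Fin n))) H
    rw [h0]
    simp only [Finset.card_empty, Nat.cast_zero, Real.logb_zero, add_zero, mul_one]
    positivity
  have hR0 : 0 < R := by linarith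
  have hRM : R * R ^ ((n : ℝ) - 1 + ε) = R ^ ((n : ℝ) + ε) := by
    nth_rw 1 [← Real.rpow_one R]
    rw [← Real.rpow_add hR0]; ring_nf
  have hM : 2 ≤ R ^ ((n : ℝ) - 1 + ε) :=
    hR.trans (Real.self_le_rpow_of_one_le (by linarith) (by linarith))
  obtain ⟨j, hj⟩ := hmain P.card H.card (by exact_mod_cast hP.card_pos) (Nat.cast_nonneg _)
  have key := PointHyperplane.incidences_le_of_cuttings (by linarith) hM (hRM ▸ hK)
    (div_nonneg (by linarith) (by linarith)) hγ0 (fun P H hH => by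
      obtain ⟨𝒰, c, h1, h2, h3⟩ := hcut P H hH
      exact ⟨𝒰, c, h1, h2, fun U => by convert h3 U⟩) j P H hH ha hb
  refine key.trans ((mul_le_mul_of_nonneg_left hj hγ0).trans (le_of_eq ?_))
  ring
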